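/- **Proposition (Approximation of the reciprocal function by attention-only Transformers).** *Definitions.* For $\lambda>0$ let $\mathrm{Softmax}_\lambda$ be the column-wise softmax, $\mathrm{Softmax}_\lambda(S)_{ik}=e^{\lambda S_{ik}}/\sum_j e^{\lambda S_{jk}}$. An $H$-head attention layer with inverse temperature $\lambda$ is a map $$\mathrm{Attn}(Z)=\sum_{h=1}^H W_V^{(h)}Z\,\mathrm{Softmax}_\lambda\big((W_K^{(h)}Z)^\top W_Q^{(h)}Z\big),\qquad W_K^{(h)},W_Q^{(h)}\in\mathbb R^{d_h\times d_{\rm in}},\ W_V^{(h)}\in\mathbb R^{d_{\rm out}\times d_{\rm in}},$$ and $W_{KQ}^{(h)}:=(W_K^{(h)})^\top W_Q^{(h)}$. For input sequences $X\in\mathbb R^{d\times n}$ (columns are tokens) let the preprocessing layer be $$P(X)=\begin{bmatrix}X&0\\ I_n&0\\ 0&1\end{bmatrix}\in\mathbb R^{(d+n+1)\times(n+1)},$$ and let $T$ delete the last token (column). Write $\mathcal T(H,W,K,C_{KQ},C_V)$ for the class of maps $T\circ\mathrm{Attn}^{(K)}\circ\cdots\circ\mathrm{Attn}^{(1)}\circ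 P$ in which every layer has $H\ge1$ heads, $K\ge 1$, all token dimensions and head dimensions are at most $W$, $\|W_{KQ}\|_F\le C_{KQ}$ and $\|W_V\|_F\le C_V$ for every head of every layer, and all layers use the same $\lambda>0$. Here $d=n=1$ and the output is a scalar. *Statement.* There are a constant $C>0$ and real polynomials $p,q$ such that for every $\epsilon\in(0,1)$ and every $C_X>0$, with $\delta:=1/\epsilon$, there exist $H,W,K,C_{KQ},C_V,\lambda$ and $f_{\rm inv}\in\mathcal T(H,W,K,C_{KQ},C_V)$ with inverse temperature $\lambda$ such that $$\Big|f_{\rm inv}(x')-\frac1x\Big|\le 2\epsilon+\frac{|x'-x|}{\epsilon^2}\qquad\text{for all }x\in[\epsilon,1/\epsilon],\ x'\in[-C_X,C_X],$$ and, whenever $C_X\ge1$, $$H\le C(1+\ln\delta)^3,\quad W\le C(1+\ln\delta)^3,\quad K\le C(1+\ln\delta)^2,\quad C_V\le C\,\delta^2\sqrt{(1+\ln\delta)^3},$$ $$C_{KQ}\le C\sqrt{(1+\ln\delta)^2\,(1+\ln(\delta C_X))},\qquad \lambda\le C\,\delta^{p(\ln\delta)}\,(1+\ln\delta)^{q(\ln\delta)}\,(1+\ln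 C_X).$$ -/

import Mathlib

namespace SoftmaxAttention

/-- Column-wise softmax with inverse temperature `lam`:
the `(i, k)` entry is `exp (lam * S i k) / ∑ j, exp (lam * S j k)`. -/
noncomputable def softmax (lam : ℝ) {m n : ℕ} (S : Matrix (Fin m) (Fin n) ℝ) :
    Matrix (Fin m) (Fin n) ℝ :=
  Matrix.of fun i k => Real.exp (lam * S i k) / ∑ j, Real.exp (lam * S j k)

/-- The Frobenius norm of a real matrix. -/
noncomputable def frobNorm {m n : ℕ} (A : Matrix (Fin m) (Fin n) ℝ) : ℝ :=
  letI : NormedAddCommGroup (Matrix (Fin m) (Fin n) ℝ) := Matrix.frobeniusNormedAddCommGroup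
  ‖A‖

theorem frobNorm_eq_sqrt {m n : ℕ} (A : Matrix (Fin m) (Fin n) ℝ) :
    frobNorm A = Real.sqrt (∑ i, ∑ j, A i j ^ 2) := by
  simp [frobNorm, Matrix.frobenius_norm_def, Real.sqrt_eq_rpow]

/-- The weights of an `H`-head self-attention layer from token dimension `din` to token
dimension `dout`; head `h` has key/query dimension `headDim h`. -/
structure AttnLayer (H din dout : ℕ) where
  headDim : Fin H → ℕ
  WK : (h : Fin H) → Matrix (Fin (headDim h)) (Fin din) ℝ
  WQ : (h : Fin H) → Matrix (Fin (headDim h)) (Fin din) ℝ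
  WV : Fin H → Matrix (Fin dout) (Fin din) ℝ

/-- `W_KQ = W_Kᵀ W_Q` of head `h`. -/
def AttnLayer.WKQ {H din dout : ℕ} (L : AttnLayer H din dout) (h : Fin H) :
    Matrix (Fin din) (Fin din) ℝ :=
  (L.WK h).transpose * L.WQ h

/-- The map `Z ↦ ∑ h, W_V Z softmax_lam ((W_K Z)ᵀ (W_Q Z))` on sequences of `n` tokens
(the tokens are the columns). -/
noncomputable def AttnLayer.eval {H din dout : ℕ} (L : AttnLayer H din dout) (lam : ℝ) {n : ℕ}
    (Z : Matrix (Fin din) (Fin n) ℝ) : Matrix (Fin dout) (Fin n) ℝ :=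
  ∑ h, L.WV h * Z * softmax lam ((L.WK h * Z).transpose * (L.WQ h * Z))

/-- All dimensions of the layer are at most `W`, all `‖W_KQ‖_F` at most `CKQ`, and all
`‖W_V‖_F` at most `CV`. -/
def AttnLayer.WithinBudget {H din dout : ℕ} (L : AttnLayer H din dout) (W : ℕ) (CKQ CV : ℝ) :
    Prop :=
  din ≤ W ∧ dout ≤ W ∧
    ∀ h, L.headDim h ≤ W ∧ frobNorm (L.WKQ h) ≤ CKQ ∧ frobNorm (L.WV h) ≤ CV

/-- A stack of `K` attention layers with `H` heads each, from token dimension `din` to token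
dimension `dout`. In `cons L N` the layer `L` is applied first. -/
inductive AttnStack (H : ℕ) : ℕ → ℕ → ℕ → Type where
  | nil (d : ℕ) : AttnStack H 0 d d
  | cons {K din dmid dout : ℕ} (L : AttnLayer H din dmid) (N : AttnStack H K dmid dout) :
      AttnStack H (K + 1) din dout

/-- The composition of the layers of a stack, all with the same inverse temperature. -/
noncomputable def AttnStack.eval (lam : ℝ) {n H : ℕ} : {K din dout : ℕ} → AttnStack H K din dout →
    Matrix (Fin din) (Fin n) ℝ → Matrix (Fin dout) (Fin n) ℝ
  | _, _, _, .nil _, Z => Z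
  | _, _, _, .cons L N, Z => N.eval lam (L.eval lam Z)

/-- Every layer of the stack is within the budget. -/
def AttnStack.WithinBudget (W : ℕ) (CKQ CV : ℝ) {H : ℕ} :
    {K din dout : ℕ} → AttnStack H K din dout → Prop
  | _, _, _, .nil _ => True
  | _, _, _, .cons L N => L.WithinBudget W CKQ CV ∧ N.WithinBudget W CKQ CV

/-- The preprocessing layer: pad one zero token and append positional codes, that is
`X ↦ [X, 0; I_{n+1}]`. -/
def preprocess {d n : ℕ} (X : Matrix (Fin d) (Fin n) ℝ) :
    Matrix (Fin (d + (n + 1))) (Fin (n + 1)) ℝ :=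
  Matrix.of fun i j =>
    Fin.addCases (motive := fun _ => ℝ)
      (fun a : Fin d => Fin.lastCases (motive := fun _ => ℝ) 0 (fun k => X a k) j)
      (fun b : Fin (n + 1) => (1 : Matrix (Fin (n + 1)) (Fin (n + 1)) ℝ) b j) i

/-- The truncation layer: delete the last token. -/
def truncate {d n : ℕ} (Y : Matrix (Fin d) (Fin (n + 1)) ℝ) : Matrix (Fin d) (Fin n) ℝ :=
  Y.submatrix id Fin.castSucc

/-- The class of attention-only Transformers `T ∘ Attn_K ∘ ⋯ ∘ Attn_1 ∘ P` on `d × n` inputs with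
`dout × n` outputs, with `K` layers of `H` heads, width (all token and head dimensions) at most `W`,
`‖W_KQ‖_F ≤ CKQ` and `‖W_V‖_F ≤ CV` for every head of every layer, and softmax inverse
temperature `lam`. -/
def Transformer (d n dout H W K : ℕ) (CKQ CV lam : ℝ) :
    Set (Matrix (Fin d) (Fin n) ℝ → Matrix (Fin dout) (Fin n) ℝ) :=
  {f | 0 < H ∧ 0 < W ∧ 0 < K ∧ 0 < CKQ ∧ 0 < CV ∧ 0 < lam ∧
    ∃ N : AttnStack H K (d + (n + 1)) dout, N.WithinBudget W CKQ CV ∧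
      ∀ X, f X = truncate (N.eval lam (preprocess X))}

end SoftmaxAttention

/-! With δ = 1/ε, the reciprocal is a short sum of exponentials, and a softmax over two tokens is a
sigmoid, which in its tail is an exponential. Substituting t = e^{-hu} in 1/y = ∫ e^{-yt} dt gives
an analytic integrand on ℝ, so by Poisson summation the trapezoidal rule errs only by Fourier
coefficients at nonzero integers. These are values of Γ on Re s = 1, exponentially small in 1/h.
Taking h ~ 1/(1 + ln δ) and truncating leaves O((1 + ln δ)²) terms (`exists_expSum_approx_inv`).
Each e^{-ty} is replaced by e^b/(1 + e^{b+ty}), with relative error at most e^{-b}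
(`abs_sum_sigmoid_sub_sum_exp_le`), one head per term. A preceding layer replaces the input by a
soft maximum with ε, keeping y away from 0; two scaling layers split a factor δ⁴ to keep the value
matrices of size O(δ²). A large inverse temperature keeps the key-query matrices bounded. -/

/-! ### Decay of Γ on the line Re s = 1. -/

theorem norm_Gamma_one_add_mul_I_sq {b : ℝ} (hb : b ≠ 0) :
    ‖Complex.Gamma (1 + b * Complex.I)‖ ^ 2 = Real.pi * b / Real.sinh (Real.pi * b) := by
  have hbI : (b : ℂ) * Complex.I ≠ 0 := by simp [hb]
  have hconj : (starRingEnd ℂ) (1 + b * Complex.I) = 1 - b * Complex.I := by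
    simp [sub_eq_add_neg]
  -- The squared norm is Γ(1 + ib) Γ(1 - ib) = ib Γ(ib) Γ(1 - ib), to which the reflection formula
  -- applies.
  have h1 : ((‖Complex.Gamma (1 + b * Complex.I)‖ ^ 2 : ℝ) : ℂ)
      = ((Real.pi * b / Real.sinh (Real.pi * b) : ℝ) : ℂ) := by
    rw [Complex.ofReal_pow, ← Complex.mul_conj', ← Complex.Gamma_conj, hconj, add_comm,
      Complex.Gamma_add_one _ hbI, mul_assoc, Complex.Gamma_mul_Gamma_one_sub, ← mul_assoc,
      Complex.sin_mul_I]
    push_cast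
    have : Complex.sinh (Real.pi * b) ≠ 0 := by
      rw [← Complex.ofReal_mul, ← Complex.ofReal_sinh]
      exact_mod_cast Real.sinh_ne_zero.2 (mul_ne_zero Real.pi_ne_zero hb)
    field_simp
  exact_mod_cast h1

/-- The true exponential rate is π|b|/2; half of it is given up to absorb the polynomial factor. -/
theorem norm_Gamma_one_add_mul_I_le {b : ℝ} (hb : 1 ≤ |b|) :
    ‖Complex.Gamma (1 + b * Complex.I)‖ ≤ 2 * Real.exp (-(Real.pi * |b| / 4)) := by
  have hb0 : b ≠ 0 := by
    rintro rfl
    norm_num at hb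
  refine le_of_sq_le_sq ?_ (by positivity)
  rw [norm_Gamma_one_add_mul_I_sq hb0]
  have hab : Real.pi * b / Real.sinh (Real.pi * b)
      = Real.pi * |b| / Real.sinh (Real.pi * |b|) := by
    rcases abs_choice b with h | h <;> rw [h]
    rw [mul_neg, Real.sinh_neg, neg_div_neg_eq]
  rw [hab]
  set x := Real.pi * |b| with hx
  have hx3 : 3 ≤ x := by nlinarith [Real.pi_gt_three]
  rw [mul_pow, ← Real.exp_nat_mul, div_le_iff₀ (Real.sinh_pos_iff.2 (by linarith)), Real.sinh_eq]
  have e1 : Real.exp (((2 : ℕ) : ℝ) * -(x / 4)) * Real.exp x = Real.exp (x / 2) := by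
    rw [← Real.exp_add]; push_cast; ring_nf
  have e2 : Real.exp (((2 : ℕ) : ℝ) * -(x / 4)) * Real.exp (-x) ≤ 1 := by
    rw [← Real.exp_add, Real.exp_le_one_iff]; push_cast; linarith
  have e3 := Real.quadratic_le_exp_of_nonneg (show 0 ≤ x / 2 by linarith)
  nlinarith [sq_nonneg (x - 3)]

/-! ### The trapezoidal rule for 1/y and its truncation. -/

/-- The integrand of `∫ exp (-y * t) dt = 1 / y` after the substitution `t = exp (-h * u)`. -/
noncomputable def expIntegrand (y h u : ℝ) : ℝ := Real.exp (-h * u) * Real.exp (-(y * Real.exp (-h * u)))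

theorem expIntegrand_nonneg (y h u : ℝ) : 0 ≤ expIntegrand y h u := by
  unfold expIntegrand; positivity

theorem expIntegrand_le_exp_neg {y : ℝ} (hy : 0 < y) (h u : ℝ) :
    expIntegrand y h u ≤ Real.exp (-h * u) := by
  unfold expIntegrand
  refine mul_le_of_le_one_right (by positivity) ?_
  rw [Real.exp_le_one_iff, neg_nonpos]
  positivity

/-- Uses e^{-s} ≤ 2/s² at s = y e^{-hu}; this controls the side u → -∞. -/
theorem expIntegrand_le_exp {y : ℝ} (hy : 0 < y) (h u : ℝ) :
    expIntegrand y h u ≤ 2 / y ^ 2 * Real.exp (h * u) := by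
  unfold expIntegrand
  have hE : Real.exp (h * u) = (Real.exp (-h * u))⁻¹ := by rw [← Real.exp_neg]; ring_nf
  rw [hE]
  set w := Real.exp (-h * u)
  have hw : 0 < w := Real.exp_pos _
  have := Real.quadratic_le_exp_of_nonneg (show 0 ≤ y * w by positivity)
  rw [Real.exp_neg, ← div_eq_mul_inv, div_le_iff₀ (by positivity)]
  have h2 : (y * w) ^ 2 / 2 ≤ Real.exp (y * w) := by nlinarith [mul_pos hy hw]
  calc w = 2 / y ^ 2 * w⁻¹ * ((y * w) ^ 2 / 2) := by field_simp
    _ ≤ _ := by gcongr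

/-- The transform is the Mellin transform of e^{-y t^h} at h + 2πiξ. Rescaling t^h to t divides the
argument by h and leaves a Gamma integral. -/
theorem fourier_expIntegrand {y h : ℝ} (hy : 0 < y) (hh : 0 < h) (ξ : ℝ) :
    FourierTransform.fourier (fun u : ℝ => (expIntegrand y h u : ℂ)) ξ
      = (h : ℂ)⁻¹ * ((1 / y : ℂ) ^ (1 + (2 * Real.pi * ξ / h : ℝ) * Complex.I)
        * Complex.Gamma (1 + (2 * Real.pi * ξ / h : ℝ) * Complex.I)) := by
  have key := mellin_eq_fourier (fun t : ℝ => Complex.exp (-(y * (t ^ h : ℝ))))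
    (s := h + (2 * Real.pi * ξ : ℝ) * Complex.I)
  have hh' : (h : ℂ) ≠ 0 := by exact_mod_cast hh.ne'
  have hs : ((h : ℂ) + (2 * Real.pi * ξ : ℝ) * Complex.I) / h
      = 1 + (2 * Real.pi * ξ / h : ℝ) * Complex.I := by
    push_cast
    field
  rw [mellin_comp_rpow (fun t : ℝ => Complex.exp (-(y * (t : ℝ)))), abs_of_pos hh, hs, mellin] at key
  simp only [smul_eq_mul] at key
  rw [Complex.integral_cpow_mul_exp_neg_mul_Ioi (by simp) (by simpa using hy)] at key
  rw [Complex.real_smul, Complex.ofReal_inv] at key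
  rw [key]
  have him : ((h : ℂ) + (2 * Real.pi * ξ : ℝ) * Complex.I).im / (2 * Real.pi) = ξ := by
    have := Real.pi_pos
    simp
  have hre : ((h : ℂ) + (2 * Real.pi * ξ : ℝ) * Complex.I).re = h := by simp
  rw [him, hre]
  refine congrArg (fun f : ℝ → ℂ => FourierTransform.fourier f ξ) (funext fun u => ?_)
  rw [expIntegrand, ← Real.exp_mul, Complex.real_smul]
  push_cast
  ring_nf

theorem norm_fourier_expIntegrand_le {y h : ℝ} (hy : 0 < y) (hh : 0 < h) (hh1 : h ≤ 1) {m : ℤ}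
    (hm : m ≠ 0) :
    ‖FourierTransform.fourier (fun u : ℝ => (expIntegrand y h u : ℂ)) (m : ℝ)‖
      ≤ 2 / (h * y) * Real.exp (-(4 / h) * |(m : ℝ)|) := by
  have hm1 : (1 : ℝ) ≤ |(m : ℝ)| := by exact_mod_cast Int.one_le_abs hm
  rw [fourier_expIntegrand hy hh]
  have hc : ‖(1 / y : ℂ) ^ (1 + (2 * Real.pi * m / h : ℝ) * Complex.I)‖ = 1 / y := by
    have : (1 / y : ℂ) = ((1 / y : ℝ) : ℂ) := by push_cast; rfl
    rw [this, Complex.norm_cpow_eq_rpow_re_of_pos (by positivity)]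
    simp
  have hb : |2 * Real.pi * m / h| = 2 * Real.pi / h * |(m : ℝ)| := by
    have := Real.pi_pos
    rw [mul_div_right_comm, abs_mul, abs_of_pos (by positivity)]
  have h6 : 6 / h ≤ 2 * Real.pi / h := by gcongr; linarith [Real.pi_gt_three]
  have h6' : 6 ≤ 6 / h := by rw [le_div_iff₀ hh]; linarith
  have hG := norm_Gamma_one_add_mul_I_le (b := 2 * Real.pi * m / h) (by rw [hb]; nlinarith)
  rw [norm_mul, norm_mul, hc, norm_inv, Complex.norm_real, Real.norm_of_nonneg hh.le]
  calc h⁻¹ * (1 / y * ‖Complex.Gamma (1 + (2 * Real.pi * m / h : ℝ) * Complex.I)‖)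
      ≤ h⁻¹ * (1 / y * (2 * Real.exp (-(Real.pi * |2 * Real.pi * m / h| / 4)))) := by gcongr
    _ = 2 / (h * y) * Real.exp (-(Real.pi * |2 * Real.pi * m / h| / 4)) := by field_simp
    _ ≤ _ := by
      gcongr
      rw [hb, neg_mul, neg_le_neg_iff]
      -- This amounts to π² ≥ 8.
      have h4 : 4 / h ≤ Real.pi * (2 * Real.pi / h) / 4 := by
        rw [mul_div_assoc', div_div, div_le_div_iff₀ hh (by positivity)]
        nlinarith [mul_pos (sub_pos.2 Real.pi_gt_three) hh, Real.pi_gt_three,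
          mul_pos (mul_pos (sub_pos.2 Real.pi_gt_three) Real.pi_pos) hh]
      calc 4 / h * |(m : ℝ)| ≤ Real.pi * (2 * Real.pi / h) / 4 * |(m : ℝ)| := by gcongr
        _ = _ := by ring

theorem summable_of_norm_le_exp {E : Type*} [NormedAddCommGroup E] [CompleteSpace E]
    {f : ℕ → E} {A c : ℝ} (hc : 0 < c) (hf : ∀ n : ℕ, ‖f n‖ ≤ A * Real.exp (-c * n)) :
    Summable f := by
  refine Summable.of_norm_bounded (Summable.mul_left A ?_) hf
  simpa [mul_comm] using Real.summable_exp_nat_mul_iff.2 (neg_lt_zero.2 hc)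

theorem norm_tsum_add_le_of_norm_le_exp {E : Type*} [NormedAddCommGroup E]
    {f : ℕ → E} {A c : ℝ} (hc : 0 < c) (hf : ∀ n : ℕ, ‖f n‖ ≤ A * Real.exp (-c * n)) (N : ℕ) :
    ‖∑' n, f (n + N)‖ ≤ A * Real.exp (-c * N) * (1 - Real.exp (-c))⁻¹ := by
  refine tsum_of_norm_bounded
    ((hasSum_geometric_of_lt_one (Real.exp_pos (-c)).le (by simpa using hc)).mul_left _)
    fun n => (hf (n + N)).trans_eq ?_
  rw [mul_assoc, ← Real.exp_nat_mul, ← Real.exp_add]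
  push_cast
  ring_nf

/-- Both one-sided tails are dominated by geometric series. In the application f 0 is the integral
and the rest is the aliasing error. -/
theorem norm_tsum_int_sub_le_of_norm_le_exp {f : ℤ → ℂ} {A c : ℝ} (hc : 0 < c)
    (hf : ∀ n : ℤ, n ≠ 0 → ‖f n‖ ≤ A * Real.exp (-c * |(n : ℝ)|)) :
    Summable f ∧ ‖∑' n, f n - f 0‖ ≤ 2 * A * Real.exp (-c) * (1 - Real.exp (-c))⁻¹ := by
  have h1 : ∀ n : ℕ, ‖f (n + 1 : ℕ)‖ ≤ A * Real.exp (-c) * Real.exp (-c * n) := fun n => by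
    refine (hf _ (by positivity)).trans_eq ?_
    rw [mul_assoc, ← Real.exp_add]
    push_cast
    rw [abs_of_nonneg (by positivity)]
    ring_nf
  have h2 : ∀ n : ℕ, ‖f (-(n + 1))‖ ≤ A * Real.exp (-c) * Real.exp (-c * n) := fun n => by
    refine (hf _ (by omega)).trans_eq ?_
    rw [mul_assoc, ← Real.exp_add]
    push_cast
    rw [abs_neg, abs_of_nonneg (by positivity)]
    ring_nf
  have s1 : Summable fun n : ℕ => f n :=
    (summable_nat_add_iff (f := fun n : ℕ => f n) 1).1 (summable_of_norm_le_exp hc h1)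
  have s2 := summable_of_norm_le_exp hc h2
  refine ⟨.of_nat_of_neg_add_one s1 s2, ?_⟩
  rw [tsum_of_nat_of_neg_add_one s1 s2, s1.tsum_eq_zero_add]
  have b1 := norm_tsum_add_le_of_norm_le_exp hc h1 0
  have b2 := norm_tsum_add_le_of_norm_le_exp hc h2 0
  simp only [add_zero, Nat.cast_zero, mul_zero, Real.exp_zero, mul_one] at b1 b2
  calc _ = ‖∑' n : ℕ, f (n + 1 : ℕ) + ∑' n : ℕ, f (-(n + 1))‖ := by
        congr 1; simp only [Nat.cast_zero]; ring
    _ ≤ _ := (norm_add_le _ _).trans (by linarith)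

/-- The decay that Poisson summation requires. -/
theorem isBigO_expIntegrand {y h : ℝ} (hy : 0 < y) (hh : 0 < h) :
    (fun u : ℝ => (expIntegrand y h u : ℂ)) =O[Filter.cocompact ℝ] fun u => |u| ^ (-2 : ℝ) := by
  refine Asymptotics.IsBigO.of_bound ((1 + 2 / y ^ 2) * (2 / h ^ 2)) ?_
  filter_upwards [(isCompact_singleton (x := (0 : ℝ))).compl_mem_cocompact] with u hu
  have hu0 : 0 < |u| := abs_pos.2 hu
  rw [Complex.norm_real, Real.norm_of_nonneg (expIntegrand_nonneg _ _ _),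
    Real.norm_of_nonneg (by positivity), Real.rpow_neg hu0.le, Real.rpow_two]
  have hq := Real.quadratic_le_exp_of_nonneg (show 0 ≤ h * |u| by positivity)
  have hE : Real.exp (-(h * |u|)) ≤ 2 / h ^ 2 * (|u| ^ 2)⁻¹ := by
    rw [Real.exp_neg, inv_le_comm₀ (Real.exp_pos _) (by positivity)]
    refine le_trans (le_of_eq ?_) (show (h * |u|) ^ 2 / 2 ≤ _ by nlinarith [mul_pos hh hu0])
    field_simp
  have hg : expIntegrand y h u ≤ (1 + 2 / y ^ 2) * Real.exp (-(h * |u|)) := by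
    have hp := Real.exp_pos (-(h * |u|))
    have h2 : 0 < 2 / y ^ 2 := by positivity
    have h3 := mul_pos h2 hp
    rw [add_mul, one_mul]
    rcases abs_cases u with ⟨ha, _⟩ | ⟨ha, _⟩
    · have := expIntegrand_le_exp_neg hy h u
      rw [neg_mul] at this
      rw [ha] at h3 ⊢
      linarith
    · have := expIntegrand_le_exp hy h u
      rw [ha, mul_neg, neg_neg] at hp h3 ⊢
      linarith
  calc _ ≤ _ := hg
    _ ≤ (1 + 2 / y ^ 2) * (2 / h ^ 2 * (|u| ^ 2)⁻¹) := by gcongr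
    _ = _ := by ring

/-- Makes the truncated tails, once multiplied by the step h, bounded uniformly in h. -/
theorem inv_one_sub_exp_neg_le {h : ℝ} (hh : 0 < h) (hh1 : h ≤ 1) :
    h * (1 - Real.exp (-h))⁻¹ ≤ 2 := by
  have h1 := Real.quadratic_le_exp_of_nonneg hh.le
  have h2 : Real.exp (-h) ≤ 1 - h / 2 := by
    rw [Real.exp_neg, inv_le_comm₀ (Real.exp_pos _) (by linarith)]
    refine le_trans ?_ h1
    rw [inv_le_iff_one_le_mul₀ (by linarith)]
    nlinarith [mul_nonneg hh.le (sub_nonneg.2 hh1)]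
  rw [← div_eq_mul_inv, div_le_iff₀ (by linarith)]
  linarith

/-- The trapezoidal rule for `∫ u, h * expIntegrand y h u = 1 / y` converges exponentially fast. -/
theorem abs_tsum_expIntegrand_sub_le {y h : ℝ} (hy : 0 < y) (hh : 0 < h) (hh1 : h ≤ 1) :
    |h * ∑' n : ℤ, expIntegrand y h n - 1 / y| ≤ 8 / y * Real.exp (-(4 / h)) := by
  have h4 : 4 ≤ 4 / h := by rw [le_div_iff₀ hh]; linarith
  obtain ⟨hs, hb⟩ := norm_tsum_int_sub_le_of_norm_le_exp (by positivity : 0 < 4 / h)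
    (fun m hm => norm_fourier_expIntegrand_le hy hh hh1 hm)
  -- Poisson summation; the zeroth coefficient is 1/(hy).
  have hP := Real.tsum_eq_tsum_fourier_of_rpow_decay_of_summable
    (f := fun u : ℝ => (expIntegrand y h u : ℂ)) (by unfold expIntegrand; fun_prop)
    one_lt_two (isBigO_expIntegrand hy hh) hs 0
  simp only [zero_add, QuotientAddGroup.mk_zero, fourier_eval_zero, mul_one] at hP
  have h0 := fourier_expIntegrand hy hh 0
  simp only [mul_zero, zero_div, Complex.ofReal_zero, zero_mul, add_zero, Complex.cpow_one,
    Complex.Gamma_one, mul_one] at h0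
  rw [← hP, Int.cast_zero, h0, ← Complex.ofReal_tsum] at hb
  have hE : (1 - Real.exp (-(4 / h)))⁻¹ ≤ 2 := by
    rw [inv_le_comm₀ _ (by norm_num)]
    · have := Real.add_one_le_exp (4 / h)
      have : Real.exp (-(4 / h)) ≤ 1 / 2 := by
        rw [Real.exp_neg, inv_le_comm₀ (Real.exp_pos _) (by norm_num)]; norm_num; linarith
      linarith
    · simp; positivity
  have hb' : |∑' n : ℤ, expIntegrand y h n - h⁻¹ * (1 / y)| ≤
      2 * (2 / (h * y)) * Real.exp (-(4 / h)) * 2 := by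
    refine le_trans (le_of_eq ?_) (hb.trans (by gcongr))
    rw [← Real.norm_eq_abs, ← Complex.norm_real]
    push_cast
    rfl
  calc _ = h * |∑' n : ℤ, expIntegrand y h n - h⁻¹ * (1 / y)| := by
        rw [← abs_of_pos hh, ← abs_mul, abs_of_pos hh]
        congr 1
        field_simp
    _ ≤ h * (2 * (2 / (h * y)) * Real.exp (-(4 / h)) * 2) := by gcongr
    _ = _ := by field

theorem abs_sum_expIntegrand_sub_le {y h : ℝ} (hy : 0 < y) (hh : 0 < h) (hh1 : h ≤ 1) (N : ℕ) :
    |(h * ∑ k ∈ Finset.range N, expIntegrand y h k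
        + h * ∑ k ∈ Finset.range N, expIntegrand y h (-(k + 1))) - 1 / y|
      ≤ 8 / y * Real.exp (-(4 / h)) + (2 + 4 / y ^ 2) * Real.exp (-h * N) := by
  have h1 : ∀ n : ℕ, ‖expIntegrand y h n‖ ≤ 1 * Real.exp (-h * n) := fun n => by
    rw [Real.norm_of_nonneg (expIntegrand_nonneg _ _ _), one_mul]
    exact expIntegrand_le_exp_neg hy h n
  have h2 : ∀ n : ℕ, ‖expIntegrand y h (-(n + 1))‖ ≤ 2 / y ^ 2 * Real.exp (-h * n) := fun n => by
    rw [Real.norm_of_nonneg (expIntegrand_nonneg _ _ _)]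
    refine (expIntegrand_le_exp hy h _).trans ?_
    exact mul_le_mul_of_nonneg_left (Real.exp_le_exp.2 (by linarith)) (by positivity)
  have s1 := summable_of_norm_le_exp hh h1
  have s2 := summable_of_norm_le_exp hh h2
  have hT := abs_tsum_expIntegrand_sub_le hy hh hh1
  rw [tsum_of_nat_of_neg_add_one (f := fun n : ℤ => expIntegrand y h n) (by simpa using s1)
    (by simpa using s2)] at hT
  simp only [Int.cast_natCast, Int.cast_neg, Int.cast_add, Int.cast_one] at hT
  rw [← s1.sum_add_tsum_nat_add N, ← s2.sum_add_tsum_nat_add N] at hT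
  have t1 := norm_tsum_add_le_of_norm_le_exp hh h1 N
  have t2 := norm_tsum_add_le_of_norm_le_exp hh h2 N
  have hinv := inv_one_sub_exp_neg_le hh hh1
  rw [Real.norm_eq_abs] at t1 t2
  have t1' := mul_le_mul_of_nonneg_left t1 hh.le
  have t2' := mul_le_mul_of_nonneg_left t2 hh.le
  have hE := Real.exp_pos (-h * N)
  set R := (1 - Real.exp (-h))⁻¹
  have r1 : h * (1 * Real.exp (-h * N) * R) ≤ 2 * Real.exp (-h * N) := by nlinarith
  have r2 : h * (2 / y ^ 2 * Real.exp (-h * N) * R) ≤ 4 / y ^ 2 * Real.exp (-h * N) := by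
    calc _ = h * R * (2 / y ^ 2 * Real.exp (-h * N)) := by ring
      _ ≤ 2 * (2 / y ^ 2 * Real.exp (-h * N)) := by gcongr
      _ = _ := by ring
  set T1 := ∑' i : ℕ, expIntegrand y h ((i + N : ℕ) : ℝ)
  set T2 := ∑' i : ℕ, expIntegrand y h (-(((i + N : ℕ) : ℝ) + 1))
  have e1 := abs_le.1 (show |h * T1| ≤ 2 * Real.exp (-h * N) by
    rw [abs_mul, abs_of_pos hh]; linarith)
  have e2 := abs_le.1 (show |h * T2| ≤ 4 / y ^ 2 * Real.exp (-h * N) by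
    rw [abs_mul, abs_of_pos hh]; linarith)
  have e3 := abs_le.1 hT
  rw [abs_le]
  constructor <;> linarith [e1.1, e1.2, e2.1, e2.2, e3.1, e3.2]

/-! ### Choice of step and number of nodes. -/

/-- `1 / y` is approximated on `[1 / (2 δ), ∞)` by a sum of `O((1 + log δ) ^ 2)` exponentials. -/
theorem exists_expSum_approx_inv {δ : ℝ} (hδ : 1 ≤ δ) :
    ∃ (M : ℕ) (t w : Fin M → ℝ), 2 ≤ M ∧ (M : ℝ) ≤ 30 * (1 + Real.log δ) ^ 2 ∧
      (∀ i, 0 ≤ t i ∧ t i ≤ 450 * δ ^ 3) ∧ (∀ i, 0 ≤ w i ∧ w i ≤ 450 * δ ^ 3) ∧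
      ∀ y, 1 / (2 * δ) ≤ y →
        |∑ i, w i * Real.exp (-(y * t i)) - 1 / y| ≤ 1 / (4 * δ) := by
  have hδ0 : 0 < δ := by linarith
  have hl : 0 ≤ Real.log δ := Real.log_nonneg hδ
  set l := Real.log δ
  have hel : Real.exp l = δ := Real.exp_log hδ0
  -- Then e^{-4/h} = e^{-8} δ^{-4}, which beats the factor 1/y ≤ 2δ.
  set h := 1 / (l + 2) with hdef
  have hh : 0 < h := by positivity
  have hh1 : h ≤ 1 := by rw [hdef, div_le_one (by positivity)]; linarith
  have hhl : h * ((3 * l + 5) * (l + 2)) = 3 * l + 5 := by rw [hdef]; field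
  -- Hence 3l + 5 ≤ hN ≤ 3l + 6: the lower bound makes the tails O(δ^{-3}) against 1/y² ≤ 4δ², the
  -- upper one bounds the nodes by e⁶δ³ ≤ 450δ³.
  obtain ⟨N, hN0, hN1, hN2⟩ : ∃ N : ℕ, 0 < N ∧ (3 * l + 5) * (l + 2) ≤ N ∧
      (N : ℝ) ≤ (3 * l + 5) * (l + 2) + 1 :=
    ⟨⌈(3 * l + 5) * (l + 2)⌉₊, Nat.ceil_pos.2 (by positivity), Nat.le_ceil _,
      (Nat.ceil_lt_add_one (by positivity)).le⟩
  have e6 : Real.exp 6 ≤ 450 := by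
    calc Real.exp 6 = Real.exp 1 ^ 6 := by rw [← Real.exp_nat_mul]; norm_num
      _ ≤ 2.7182818286 ^ 6 := by gcongr; exact Real.exp_one_lt_d9.le
      _ ≤ 450 := by norm_num
  have e5 : 100 ≤ Real.exp 5 := by
    calc (100 : ℝ) ≤ 2.7182818283 ^ 5 := by norm_num
      _ ≤ Real.exp 1 ^ 5 := by gcongr; exact Real.exp_one_gt_d9.le
      _ = _ := by rw [← Real.exp_nat_mul]; norm_num
  let s : Fin (N + N) → ℝ := Fin.append (fun k => (k : ℝ)) (fun k => -((k : ℝ) + 1))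
  have hs : ∀ i, -s i ≤ N := by
    intro i
    refine Fin.addCases (fun k => ?_) (fun k => ?_) i
    · simp only [s, Fin.append_left]
      exact (neg_nonpos.2 (Nat.cast_nonneg _)).trans (Nat.cast_nonneg _)
    · simp only [s, Fin.append_right, neg_neg]
      exact_mod_cast k.2
  have ht : ∀ i, Real.exp (-h * s i) ≤ 450 * δ ^ 3 := fun i => by
    have : -h * s i ≤ 3 * l + 6 := by
      have := mul_le_mul_of_nonneg_left ((hs i).trans hN2) hh.le
      linarith
    calc Real.exp (-h * s i) ≤ Real.exp (3 * l + 6) := by gcongr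
      _ = Real.exp 6 * Real.exp l ^ 3 := by
        rw [← Real.exp_nat_mul, ← Real.exp_add]; push_cast; ring_nf
      _ ≤ _ := by rw [hel]; gcongr
  refine ⟨N + N, fun i => Real.exp (-h * s i), fun i => h * Real.exp (-h * s i), by omega, ?_,
    fun i => ⟨by positivity, ht i⟩, fun i => ⟨by positivity, ?_⟩, fun y hy => ?_⟩
  · push_cast
    nlinarith
  · exact (mul_le_of_le_one_left (by positivity) hh1).trans (ht i)
  have hy0 : 0 < y := lt_of_lt_of_le (by positivity) hy
  have hsum : ∑ i, h * Real.exp (-h * s i) * Real.exp (-(y * Real.exp (-h * s i)))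
      = h * ∑ k ∈ Finset.range N, expIntegrand y h k
        + h * ∑ k ∈ Finset.range N, expIntegrand y h (-(k + 1)) := by
    simp_rw [mul_assoc h, ← Finset.mul_sum]
    rw [Fin.sum_univ_add, ← mul_add, Finset.sum_range, Finset.sum_range]
    simp only [s, Fin.append_left, Fin.append_right, expIntegrand]
  rw [hsum]
  refine (abs_sum_expIntegrand_sub_le hy0 hh hh1 N).trans ?_
  have hyinv : 1 / y ≤ 2 * δ := by
    rw [div_le_comm₀ hy0 (by positivity)]; exact hy
  have q1 : Real.exp (-(4 / h)) ≤ 1 / (1000 * δ ^ 2) := by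
    have : Real.exp (4 / h) = Real.exp 5 * Real.exp 3 * (Real.exp l ^ 4) := by
      rw [← Real.exp_nat_mul, ← Real.exp_add, ← Real.exp_add, hdef]
      push_cast
      congr 1
      field
    have e3 : 10 ≤ Real.exp 3 := by
      calc (10 : ℝ) ≤ 2.7182818283 ^ 3 := by norm_num
        _ ≤ Real.exp 1 ^ 3 := by gcongr; exact Real.exp_one_gt_d9.le
        _ = _ := by rw [← Real.exp_nat_mul]; norm_num
    rw [Real.exp_neg, ← one_div]
    refine one_div_le_one_div_of_le (by positivity) ?_
    rw [this, hel]
    calc 1000 * δ ^ 2 = 100 * 10 * δ ^ 2 := by ring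
      _ ≤ Real.exp 5 * Real.exp 3 * δ ^ 4 := by gcongr; norm_num
  have q2 : Real.exp (-h * N) ≤ 1 / (100 * δ ^ 3) := by
    rw [neg_mul, Real.exp_neg, ← one_div]
    refine one_div_le_one_div_of_le (by positivity) ?_
    calc 100 * δ ^ 3 ≤ Real.exp 5 * δ ^ 3 := by gcongr
      _ = Real.exp (3 * l + 5) := by
        rw [← hel, ← Real.exp_nat_mul, ← Real.exp_add]; push_cast; ring_nf
      _ ≤ Real.exp (h * N) := by
        rw [← hhl]; gcongr
  calc 8 / y * Real.exp (-(4 / h)) + (2 + 4 / y ^ 2) * Real.exp (-h * N)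
      = 8 * (1 / y) * Real.exp (-(4 / h)) + (2 + 4 * (1 / y) ^ 2) * Real.exp (-h * N) := by ring
    _ ≤ 8 * (2 * δ) * (1 / (1000 * δ ^ 2)) + (2 * δ ^ 2 + 4 * (2 * δ) ^ 2) * (1 / (100 * δ ^ 3)) := by
      gcongr
      nlinarith
    _ = (16 / 1000 + 18 / 100) / δ := by field
    _ ≤ (1 / 4) / δ := by gcongr; norm_num
    _ = _ := by ring

/-! ### Attention layers: values, weight bounds and errors. -/

namespace SoftmaxAttention

theorem preprocess_one_one (x : ℝ) : preprocess !![x] = (!![x, 0; 1, 0; 0, 1] : Matrix (Fin 3) (Fin 2) ℝ) := by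
  ext i j
  fin_cases i <;> fin_cases j <;> simp [preprocess] <;> rfl

/-- A layer all of whose heads have dimension one. -/
def rankOneLayer {H din dout : ℕ} (k q : Fin H → Fin din → ℝ)
    (V : Fin H → Matrix (Fin dout) (Fin din) ℝ) : AttnLayer H din dout where
  headDim _ := 1
  WK h := Matrix.of fun _ => k h
  WQ h := Matrix.of fun _ => q h
  WV := V

theorem rankOneLayer_eval_apply {H din dout n : ℕ} (k q : Fin H → Fin din → ℝ)
    (V : Fin H → Matrix (Fin dout) (Fin din) ℝ) (lam : ℝ) (Z : Matrix (Fin din) (Fin n) ℝ)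
    (i : Fin dout) (c : Fin n) :
    (rankOneLayer k q V).eval lam Z i c = ∑ h, ∑ j, (∑ a, V h i a * Z a j) *
      (Real.exp (lam * ((∑ a, k h a * Z a j) * (∑ a, q h a * Z a c))) /
        ∑ j', Real.exp (lam * ((∑ a, k h a * Z a j') * (∑ a, q h a * Z a c)))) := by
  have hS : ∀ h j c, ((((rankOneLayer k q V).WK h * Z).transpose *
      ((rankOneLayer k q V).WQ h * Z) : Matrix (Fin n) (Fin n) ℝ)) j c
      = (∑ a, k h a * Z a j) * (∑ a, q h a * Z a c) := fun h j c =>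
    Fin.sum_univ_one fun _ => (∑ a, k h a * Z a j) * (∑ a, q h a * Z a c)
  rw [AttnLayer.eval, Matrix.sum_apply]
  refine Finset.sum_congr rfl fun h _ => ?_
  rw [Matrix.mul_apply]
  refine Finset.sum_congr rfl fun j _ => ?_
  simp only [softmax, Matrix.of_apply, hS]
  rw [Matrix.mul_apply]
  rfl

theorem rankOneLayer_WKQ_apply {H din dout : ℕ} (k q : Fin H → Fin din → ℝ)
    (V : Fin H → Matrix (Fin dout) (Fin din) ℝ) (h : Fin H) (a b : Fin din) :
    (rankOneLayer k q V).WKQ h a b = k h a * q h b :=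
  Fin.sum_univ_one fun _ => k h a * q h b

/-- The first layer: head `0` computes the soft maximum of `ε` and the first coordinate,
head `1` passes on the positional codes, all other heads vanish. -/
def softMaxLayer (ε a : ℝ) (m : ℕ) : AttnLayer (m + 2) 3 3 :=
  rankOneLayer (Fin.cons ![1, 0, ε] (Fin.cons ![0, a, 0] fun _ => 0))
    (Fin.cons ![0, 1, 1] (Fin.cons ![0, 1, 0] fun _ => 0))
    (Fin.cons !![1, 0, ε; 0, 0, 0; 0, 0, 0]
      (Fin.cons !![0, 0, 0; 0, 2, -2; 0, -1, 3] fun _ => 0))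

/-- A layer whose heads evaluate the sigmoids `u ↦ v i / (1 + exp (b + t i * u))`. -/
noncomputable def sigmoidLayer {M : ℕ} (lam b : ℝ) (t v : Fin M → ℝ) : AttnLayer M 3 1 :=
  rankOneLayer (fun _ => ![0, 1, 0]) (fun i => ![-(t i / lam), -(b / lam), -(b / lam)])
    (fun i => !![0, v i, 0])

/-- A layer that multiplies sequences of equal scalar tokens by `a`. -/
def scalingLayer (a : ℝ) (m : ℕ) : AttnLayer (m + 1) 1 1 :=
  rankOneLayer (fun _ => 0) (fun _ => 0) (Fin.cons !![a] fun _ => 0)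

/-- The mean of `x` and `ε` with weights proportional to `exp (lam * x)` and `exp (lam * ε)`. -/
noncomputable def softMax (lam ε x : ℝ) : ℝ :=
  (x * Real.exp (lam * x) + ε * Real.exp (lam * ε)) / (Real.exp (lam * x) + Real.exp (lam * ε))

/-- In head 1, since 3 = e^{log 3}, the softmax matrix is [3/4, 1/2; 1/4, 1/2]; the block [2, -2;
-1, 3] of its value matrix is the inverse, so the positional codes survive exactly. -/
theorem eval_softMaxLayer {lam : ℝ} (hlam : 0 < lam) (ε x : ℝ) (m : ℕ) :
    (softMaxLayer ε (Real.log 3 / lam) m).eval lam !![x, 0; 1, 0; 0, 1]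
      = !![softMax lam ε x, softMax lam ε x; 1, 0; 0, 1] := by
  have h3 : lam * (Real.log 3 / lam) = Real.log 3 := by field
  have hp : Real.exp (lam * x) + Real.exp (lam * ε) ≠ 0 := by positivity
  ext i k
  rw [softMaxLayer, rankOneLayer_eval_apply]
  fin_cases i <;> fin_cases k <;>
    simp [Fin.sum_univ_succ, h3, Real.exp_log, softMax] <;> field

/-- The scaled scores of the two tokens are -(b + t y) and 0, and only the first token carries a
value. -/
theorem eval_sigmoidLayer {M : ℕ} {lam : ℝ} (hlam : 0 < lam) (b y : ℝ) (t v : Fin M → ℝ) :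
    (sigmoidLayer lam b t v).eval lam !![y, y; 1, 0; 0, 1]
      = !![∑ i, v i / (1 + Real.exp (b + t i * y)), ∑ i, v i / (1 + Real.exp (b + t i * y))] := by
  have h : ∀ i, lam * (-(t i / lam * y) + -(b / lam)) = -(b + t i * y) := fun i => by field
  ext i k
  rw [sigmoidLayer, rankOneLayer_eval_apply]
  fin_cases i
  fin_cases k <;>
  · simp only [Fin.sum_univ_succ]
    simp only [Fin.sum_univ_zero]
    simp [h]
    refine Finset.sum_congr rfl fun i _ => ?_
    rw [← neg_add, add_comm (t i * y), Real.exp_neg]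
    field

/-- Zero scores average the tokens uniformly, and both are equal. -/
theorem eval_scalingLayer (lam a s : ℝ) (m : ℕ) :
    (scalingLayer a m).eval lam !![s, s] = !![a * s, a * s] := by
  ext i k
  rw [scalingLayer, rankOneLayer_eval_apply]
  fin_cases i
  fin_cases k <;>
  · simp [Fin.sum_univ_succ]
    ring

theorem withinBudget_softMaxLayer {ε a CV : ℝ} (hε : 0 ≤ ε) (hε1 : ε ≤ 1) (ha : |a| ≤ 2)
    (hCV : 5 ≤ CV) (m : ℕ) : (softMaxLayer ε a m).WithinBudget 3 2 CV := by
  refine ⟨le_rfl, le_rfl, fun i => ⟨by simp [softMaxLayer, rankOneLayer], ?_, le_trans ?_ hCV⟩⟩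
  · rw [frobNorm_eq_sqrt, Real.sqrt_le_left (by norm_num)]
    have ha2 := sq_le_sq' (abs_le.1 ha).1 (abs_le.1 ha).2
    simp only [softMaxLayer, rankOneLayer_WKQ_apply]
    refine Fin.cases ?_ (Fin.cases ?_ fun i => ?_) i <;>
      simp [Fin.sum_univ_succ] <;> nlinarith
  · rw [frobNorm_eq_sqrt, Real.sqrt_le_left (by norm_num)]
    refine Fin.cases ?_ (Fin.cases ?_ fun i => ?_) i <;>
      simp [softMaxLayer, rankOneLayer, Fin.sum_univ_succ] <;> nlinarith

theorem withinBudget_sigmoidLayer {M : ℕ} {lam b CV : ℝ} {t v : Fin M → ℝ}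
    (hb : |b / lam| ≤ 1) (ht : ∀ i, |t i / lam| ≤ 1) (hv : ∀ i, |v i| ≤ CV) :
    (sigmoidLayer lam b t v).WithinBudget 3 2 CV := by
  refine ⟨le_rfl, by norm_num, fun i => ⟨by simp [sigmoidLayer, rankOneLayer], ?_, ?_⟩⟩
  · rw [frobNorm_eq_sqrt, Real.sqrt_le_left (by norm_num)]
    have h1 := (sq_le_one_iff_abs_le_one _).2 hb
    have h2 := (sq_le_one_iff_abs_le_one _).2 (ht i)
    simp only [sigmoidLayer, rankOneLayer_WKQ_apply]
    generalize b / lam = r at *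
    generalize t i / lam = r' at *
    simp [Fin.sum_univ_succ]
    linarith
  · rw [frobNorm_eq_sqrt]
    simpa [sigmoidLayer, rankOneLayer, Fin.sum_univ_succ, Real.sqrt_sq_eq_abs] using hv i

theorem withinBudget_scalingLayer {a CV : ℝ} (ha : |a| ≤ CV) (m : ℕ) :
    (scalingLayer a m).WithinBudget 3 2 CV := by
  refine ⟨by norm_num, by norm_num, fun i => ⟨by simp [scalingLayer, rankOneLayer], ?_, ?_⟩⟩
  · rw [frobNorm_eq_sqrt]
    simp only [scalingLayer, rankOneLayer_WKQ_apply]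
    simp
  · rw [frobNorm_eq_sqrt]
    refine Fin.cases ?_ (fun i => ?_) i
    · simpa [scalingLayer, rankOneLayer, Real.sqrt_sq_eq_abs] using ha
    · simpa [scalingLayer, rankOneLayer] using (abs_nonneg a).trans ha

/-- For u ≤ v the deficit from v is (v - u)/(1 + e^{λ(v-u)}), and e^s ≥ s. -/
theorem abs_softMax_sub_max_le {lam : ℝ} (hlam : 0 < lam) (ε x : ℝ) :
    |softMax lam ε x - max x ε| ≤ 1 / lam := by
  have key : ∀ u v : ℝ, u ≤ v →
      |(u * Real.exp (lam * u) + v * Real.exp (lam * v))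
        / (Real.exp (lam * u) + Real.exp (lam * v)) - v| ≤ 1 / lam := by
    intro u v huv
    have hE : Real.exp (lam * v) = Real.exp (lam * u) * Real.exp (lam * (v - u)) := by
      rw [← Real.exp_add]; ring_nf
    have e1 := Real.add_one_le_exp (lam * (v - u))
    have hq : 0 < 1 + Real.exp (lam * (v - u)) := by positivity
    have heq : (u * Real.exp (lam * u) + v * Real.exp (lam * v))
        / (Real.exp (lam * u) + Real.exp (lam * v)) - v
        = -((v - u) / (1 + Real.exp (lam * (v - u)))) := by
      rw [hE]; field
    rw [heq, abs_neg, abs_of_nonneg (div_nonneg (by linarith) hq.le),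
      div_le_div_iff₀ hq hlam]
    linarith
  unfold softMax
  rcases le_total x ε with h | h
  · rw [max_eq_right h]
    exact key x ε h
  · rw [max_eq_left h, add_comm, add_comm (Real.exp (lam * x))]
    exact key ε x h

/-- The sum of exponentials `∑ i, w i * exp (-(y * t i))` is approximated by a sum of sigmoids. -/
theorem abs_sum_sigmoid_sub_sum_exp_le {M : ℕ} {t w : Fin M → ℝ} (ht : ∀ i, 0 ≤ t i)
    (hw : ∀ i, 0 ≤ w i) (b : ℝ) {y : ℝ} (hy : 0 ≤ y) :
    |∑ i, w i * Real.exp b / (1 + Real.exp (b + t i * y)) - ∑ i, w i * Real.exp (-(y * t i))|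
      ≤ Real.exp (-b) * ∑ i, w i * Real.exp (-(y * t i)) := by
  rw [← Finset.sum_sub_distrib, Finset.mul_sum]
  refine (Finset.abs_sum_le_sum_abs _ _).trans (Finset.sum_le_sum fun i _ => ?_)
  have hu : 0 ≤ t i * y := mul_nonneg (ht i) hy
  rw [mul_comm y]
  generalize t i * y = u at hu
  have heq : w i * Real.exp b / (1 + Real.exp (b + u)) - w i * Real.exp (-u)
      = -(w i * (Real.exp (-u) / (1 + Real.exp (b + u)))) := by
    have : Real.exp b = Real.exp (b + u) * Real.exp (-u) := by
      rw [← Real.exp_add]; ring_nf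
    rw [this]
    field
  -- The relative error 1/(1 + e^{b+u}) is at most e^{-b} because u ≥ 0.
  have h1 : Real.exp (-u) / (1 + Real.exp (b + u)) ≤ Real.exp (-b) * Real.exp (-u) := by
    rw [div_le_iff₀ (by positivity), mul_right_comm]
    refine le_mul_of_one_le_left (by positivity) ?_
    rw [mul_add, ← Real.exp_add, neg_add_cancel_left]
    have := Real.one_le_exp hu
    have := Real.exp_pos (-b)
    linarith
  rw [heq, abs_neg, abs_of_nonneg (mul_nonneg (hw i) (by positivity))]
  calc _ ≤ w i * (Real.exp (-b) * Real.exp (-u)) := mul_le_mul_of_nonneg_left h1 (hw i)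
    _ = _ := by ring

end SoftmaxAttention

/-! ### Assembly of the four-layer network. -/

namespace SoftmaxAttention

/-- The error 1/δ splits into 1/(4δ) for quadrature, 1/(4δ) for the sigmoids and 1/(2δ) for the soft
maximum. -/
theorem exists_transformer_approx_inv_max {δ : ℝ} (hδ : 1 ≤ δ) :
    ∃ (H : ℕ) (f : Matrix (Fin 1) (Fin 1) ℝ → Matrix (Fin 1) (Fin 1) ℝ),
      (H : ℝ) ≤ 30 * (1 + Real.log δ) ^ 2 ∧
      f ∈ Transformer 1 1 1 H 3 4 2 (7200 * δ ^ 2) (450 * δ ^ 3) ∧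
      ∀ x, |f !![x] 0 0 - 1 / max x (1 / δ)| ≤ 1 / δ := by
  have hδ0 : 0 < δ := by linarith
  obtain ⟨M, t, w, hM, hMle, ht, hw, happ⟩ := exists_expSum_approx_inv hδ
  obtain ⟨m, rfl⟩ := Nat.exists_eq_add_of_le' hM
  -- Large enough that t i / lam ≤ 1 and that the soft maximum errs by at most 1/(4δ³).
  set lam := 450 * δ ^ 3 with hlamdef
  have hlam : 0 < lam := by positivity
  have hδ3 : 1 ≤ δ ^ 3 := one_le_pow₀ hδ
  -- The exponential sum is at most 4δ, so relative error e^{-b} costs 1/(4δ).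
  set b := Real.log (16 * δ ^ 2) with hb
  have heb : Real.exp b = 16 * δ ^ 2 := Real.exp_log (by positivity)
  have hb0 : 0 ≤ b := Real.log_nonneg (by nlinarith)
  -- The unscaled weights may reach 7200δ⁵; the two scaling layers restore δ⁴.
  let v : Fin (m + 2) → ℝ := fun i => w i * Real.exp b / δ ^ 4
  let N : AttnStack (m + 2) 4 3 1 :=
    .cons (softMaxLayer (1 / δ) (Real.log 3 / lam) m) (.cons (sigmoidLayer lam b t v)
      (.cons (scalingLayer (δ ^ 2) (m + 1)) (.cons (scalingLayer (δ ^ 2) (m + 1)) (.nil 1))))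
  have hN : ∀ x, N.eval lam (preprocess !![x]) 0 0
      = ∑ i, w i * Real.exp b / (1 + Real.exp (b + t i * softMax lam (1 / δ) x)) := fun x => by
    rw [preprocess_one_one]
    simp only [N, AttnStack.eval]
    rw [eval_softMaxLayer hlam, eval_sigmoidLayer hlam, eval_scalingLayer, eval_scalingLayer]
    simp only [v, Matrix.of_apply, Matrix.cons_val_zero, Finset.mul_sum]
    refine Finset.sum_congr rfl fun i _ => ?_
    field
  refine ⟨m + 2, fun X => truncate (N.eval lam (preprocess X)), hMle,
    ⟨by omega, by omega, by omega, by norm_num, by positivity, hlam, N, ?_, fun _ => rfl⟩,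
    fun x => ?_⟩
  · have hδ2 : δ ^ 2 ≤ 7200 * δ ^ 2 := by nlinarith
    have hs := withinBudget_scalingLayer (a := δ ^ 2) (CV := 7200 * δ ^ 2)
      (by rwa [abs_of_nonneg (by positivity)]) (m + 1)
    refine ⟨withinBudget_softMaxLayer (by positivity) (by rw [div_le_one hδ0]; exact hδ) ?_
      (by nlinarith) m, withinBudget_sigmoidLayer ?_ (fun i => ?_) (fun i => ?_), hs, hs, trivial⟩
    · have h3 := Real.log_le_sub_one_of_pos (show (0 : ℝ) < 3 by norm_num)
      have h3' := Real.log_nonneg (show (1 : ℝ) ≤ 3 by norm_num)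
      rw [abs_of_nonneg (by positivity), div_le_iff₀ hlam]
      linarith
    · have := Real.log_le_sub_one_of_pos (show 0 < 16 * δ ^ 2 by positivity)
      rw [abs_of_nonneg (by positivity), div_le_one hlam]
      nlinarith
    · rw [abs_of_nonneg (div_nonneg (ht i).1 hlam.le), div_le_one hlam]
      exact (ht i).2
    · simp only [v]
      have := (hw i).1
      rw [abs_of_nonneg (by positivity), heb, div_le_iff₀ (by positivity)]
      calc w i * (16 * δ ^ 2) ≤ 450 * δ ^ 3 * (16 * δ ^ 2) := by gcongr; exact (hw i).2
        _ = 7200 * δ ^ 5 := by ring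
        _ ≤ 7200 * δ ^ 6 := by gcongr; norm_num
        _ = _ := by ring
  · change |N.eval lam (preprocess !![x]) 0 0 - _| ≤ _
    rw [hN]
    have hz : 1 / δ ≤ max x (1 / δ) := le_max_right _ _
    have hyz := abs_softMax_sub_max_le hlam (1 / δ) x
    set y := softMax lam (1 / δ) x
    set z := max x (1 / δ)
    have hz0 : 0 < z := lt_of_lt_of_le (by positivity) hz
    have hl4 : 1 / lam ≤ 1 / (4 * δ ^ 3) := one_div_le_one_div_of_le (by positivity) (by linarith)
    have hl2 : 1 / lam ≤ 1 / (2 * δ) := one_div_le_one_div_of_le (by positivity) (by nlinarith)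
    -- The soft maximum can fall below 1/δ, hence the quadrature range starting at 1/(2δ).
    have hy : 1 / (2 * δ) ≤ y := by
      have h1 := (abs_le.1 hyz).1
      have h2 : 1 / δ = 1 / (2 * δ) + 1 / (2 * δ) := by field
      linarith
    have hy0 : 0 < y := lt_of_lt_of_le (by positivity) hy
    have hyi : 1 / y ≤ 2 * δ := by rw [div_le_comm₀ hy0 (by positivity)]; exact hy
    have hzi : 1 / z ≤ δ := by rw [div_le_comm₀ hz0 (by positivity)]; exact hz
    have e1 : |1 / y - 1 / z| ≤ 1 / (2 * δ) := by
      have : 1 / y - 1 / z = -((y - z) * (1 / y) * (1 / z)) := by field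
      rw [this, abs_neg, abs_mul, abs_mul, abs_of_pos (one_div_pos.2 hy0),
        abs_of_pos (one_div_pos.2 hz0)]
      calc _ ≤ 1 / (4 * δ ^ 3) * (2 * δ) * δ := by
            gcongr
            exact hyz.trans hl4
        _ = _ := by field
    have e2 := happ y hy
    have e3 := abs_sum_sigmoid_sub_sum_exp_le (fun i => (ht i).1) (fun i => (hw i).1) b hy0.le
    set S := ∑ i, w i * Real.exp (-(y * t i))
    have e4 : Real.exp (-b) * S ≤ 1 / (4 * δ) := by
      have hd : 1 / (4 * δ) ≤ δ := by
        rw [div_le_iff₀ (by positivity)]; nlinarith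
      have : S ≤ 4 * δ := by linarith [(abs_le.1 e2).2]
      rw [Real.exp_neg, heb]
      calc (16 * δ ^ 2)⁻¹ * S ≤ (16 * δ ^ 2)⁻¹ * (4 * δ) := by gcongr
        _ = _ := by field
    have e5 : 1 / δ = 1 / (4 * δ) + 1 / (4 * δ) + 1 / (2 * δ) := by field
    have a1 := abs_le.1 e1
    have a2 := abs_le.1 e2
    have a3 := abs_le.1 (e3.trans e4)
    rw [abs_le]
    constructor <;> linarith [a1.1, a1.2, a2.1, a2.2, a3.1, a3.2]

end SoftmaxAttention

/-! ### From the clipped reciprocal to the stated bounds. -/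

theorem mainTheorem5 :
    ∃ (C : ℝ) (p q : Polynomial ℝ), 0 < C ∧
      ∀ ε : ℝ, 0 < ε → ε < 1 → ∀ CX : ℝ, 0 < CX →
        ∃ (H W K : ℕ) (CKQ CV lam : ℝ),
          ∃ f ∈ SoftmaxAttention.Transformer 1 1 1 H W K CKQ CV lam,
            (∀ x ∈ Set.Icc ε (1 / ε), ∀ x' ∈ Set.Icc (-CX) CX,
              |f !![x'] 0 0 - 1 / x| ≤ 2 * ε + |x' - x| / ε ^ 2) ∧
            (1 ≤ CX →
              (H : ℝ) ≤ C * (1 + Real.log (1 / ε)) ^ 3 ∧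
              (W : ℝ) ≤ C * (1 + Real.log (1 / ε)) ^ 3 ∧
              (K : ℝ) ≤ C * (1 + Real.log (1 / ε)) ^ 2 ∧
              CV ≤ C * ((1 / ε) ^ 2 * Real.sqrt ((1 + Real.log (1 / ε)) ^ 3)) ∧
              CKQ ≤ C * Real.sqrt ((1 + Real.log (1 / ε)) ^ 2 * (1 + Real.log (CX / ε))) ∧
              lam ≤ C * ((1 / ε) ^ (p.eval (Real.log (1 / ε))) *
                (1 + Real.log (1 / ε)) ^ (q.eval (Real.log (1 / ε))) *
                (1 + Real.log CX))) := by
  -- 7200 comes from the value bound and the exponent 3 from λ = 450δ³; the network does not depend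
  -- on `CX`.
  refine ⟨7200, Polynomial.C 3, 0, by norm_num, fun ε hε hε1 CX hCX => ?_⟩
  have hδ : 1 ≤ 1 / ε := by rw [le_div_iff₀ hε]; linarith
  obtain ⟨H, f, hH, hf, happ⟩ := SoftmaxAttention.exists_transformer_approx_inv_max hδ
  rw [one_div_one_div] at happ
  refine ⟨H, 3, 4, 2, _, _, f, hf, fun x hx x' _ => ?_, fun hCX1 => ?_⟩
  · have h1 := happ x'
    have hz : ε ≤ max x' ε := le_max_right _ _
    -- Clipping at ε is 1-Lipschitz and fixes x.
    have hzx : |max x' ε - x| ≤ |x' - x| := by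
      have := abs_max_sub_max_le_abs x' x ε
      rwa [max_eq_left hx.1] at this
    set z := max x' ε
    have hz0 : 0 < z := hε.trans_le hz
    have hx0 : 0 < x := hε.trans_le hx.1
    -- The reciprocal is ε^{-2}-Lipschitz on [ε, ∞).
    have h2 : |1 / z - 1 / x| ≤ |x' - x| / ε ^ 2 := by
      have : 1 / z - 1 / x = -((z - x) / (z * x)) := by field
      rw [this, abs_neg, abs_div, abs_of_pos (mul_pos hz0 hx0), sq]
      gcongr
      exact hx.1
    have h3 := abs_sub_le (f !![x'] 0 0) (1 / z) (1 / x)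
    linarith
  · have hl : 0 ≤ Real.log (1 / ε) := Real.log_nonneg hδ
    have hl1 : 1 ≤ 1 + Real.log (1 / ε) := by linarith
    have hl2 : 0 ≤ Real.log CX := Real.log_nonneg hCX1
    have hl3 : 0 ≤ Real.log (CX / ε) := Real.log_nonneg (by rw [le_div_iff₀ hε]; linarith)
    have h2 := one_le_pow₀ (n := 2) hl1
    have h3 := one_le_pow₀ (n := 3) hl1
    have h23 := pow_le_pow_right₀ hl1 (show 2 ≤ 3 by norm_num)
    refine ⟨by linarith, by push_cast; linarith, by push_cast; linarith, ?_, ?_, ?_⟩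
    · have : 1 ≤ Real.sqrt ((1 + Real.log (1 / ε)) ^ 3) := Real.one_le_sqrt.2 h3
      gcongr
      exact le_mul_of_one_le_right (by positivity) this
    · have : 1 ≤ Real.sqrt ((1 + Real.log (1 / ε)) ^ 2 * (1 + Real.log (CX / ε))) :=
        Real.one_le_sqrt.2 (one_le_mul_of_one_le_of_one_le h2 (by linarith))
      linarith
    · rw [Polynomial.eval_C, Polynomial.eval_zero, Real.rpow_zero, mul_one,
        show (3 : ℝ) = ((3 : ℕ) : ℝ) by norm_num, Real.rpow_natCast]
      gcongr
      · norm_num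
      · exact le_mul_of_one_le_right (by positivity) (by linarith)
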